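/- **Conventions.** A cardinal is identified with its initial ordinal; $[X]^2$ is the set of two-element subsets of $X$ and $[X]^{<\aleph_0}$ the set of finite subsets of $X$. A *2-identity* is a pair $(N,e)$ with $N<\omega$ and $e$ an equivalence relation on $[\{0,\dots,N-1\}]^2$. For infinite cardinals $\lambda,\mu$, $\mathrm{ID}_2(\lambda,\mu)$ is the set of 2-identities $(N,e)$ such that for every $f:[\lambda]^{<\aleph_0}\to\mu$ there is a one-to-one $h:\{0,\dots,N-1\}\to\lambda$ with $b\,e\,c\Rightarrow f(h''(b))=f(h''(c))$; $\mathrm{OID}_2(\lambda,\mu)$ is defined in the same way with $h$ required to be (strictly) order preserving. A cardinal $\theta$ is *compact* if it is regular and uncountable and every proper $\theta$-complete filter on any set extends to a $\theta$-complete ultrafilter. For $n<\omega$ let $\mathbf s'_n$ be the 2-identity on $2n+n^2$ points whose non-singleton classes are the non-singletons among the two sets $$\{\{\ell_0,\,2n+n\ell_0+\ell_1\}:\ell_0,\ell_1<n\},\qquad \{\{n+\ell_1,\,2n+n\ell_0+\ell_1\}:\ell_0,\ell_1<n\}.$$ For $\nu\in{}^n2$ let $\ell(\nu)=\sum_{j<n}\nu(j)2^{\,n-1-j}$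 (so $\ell$ enumerates ${}^n2$ in lexicographic order). Let $\mathbf s''_n$ be the 2-identity on $2^n+2^{2n}$ points whose non-singleton classes are the non-singletons among the sets, for $m<n$, $\eta\in{}^m2$, $i\in\{0,1\}$, $$\mathbf a^i_\eta=\{\{\ell(\nu_i),\,2^n+2^n\ell(\nu_0)+\ell(\nu_1)\}:\nu_0,\nu_1\in{}^n2,\ \eta^\frown\langle0\rangle\trianglelefteq\nu_0,\ \eta^\frown\langle1\rangle\trianglelefteq\nu_1\},$$ where $\trianglelefteq$ means "is an initial segment of". **Claim.** (1) Let $\mu$ be a limit cardinal (not necessarily a strong limit) and $\theta$ a compact cardinal with $\mathrm{cf}(\mu)<\theta<\mu$. Then for every $n<\omega$, $\mathbf s'_n$ and $\mathbf s''_n$ belong to $\mathrm{OID}_2(\mu^+,\mu)$, and hence to $\mathrm{ID}_2(\mu^+,\mu)$. (2) For every $n\ge2$, neither $\mathbf s'_n$ nor $\mathbf s''_n$ belongs to $\mathrm{ID}_2(\aleph_1,\aleph_0)$. -/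

import Mathlib

open Cardinal

universe u

namespace CardinalIdentity

/-- A partial identity on the (finite) set `a`: an equivalence relation on a subfamily `dom` of the
family of finite subsets of `a`, any two equivalent sets having the same cardinality. -/
structure PartialIdentity (a : Type) where
  dom : Set (Finset a)
  rel : Finset a → Finset a → Prop
  rel_dom : ∀ {b c}, rel b c → b ∈ dom ∧ c ∈ dom
  refl : ∀ {b}, b ∈ dom → rel b b
  symm : ∀ {b c}, rel b c → rel c b
  trans : ∀ {b c d}, rel b c → rel c d → rel b d
  card_eq : ∀ {b c}, rel b c → b.card = c.card

/-- `lam → (a, e)_mu`: for every colouring of the finite subsets of `lam` by elements of `mu` there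
is a one-to-one `h : a → lam` such that `e`-equivalent sets have images of the same colour.
A cardinal is identified with its initial ordinal. -/
def Arrows (lam mu : Cardinal.{u}) {a : Type} (s : PartialIdentity a) : Prop :=
  ∀ f : Finset lam.ord.ToType → mu.ord.ToType,
    ∃ h : a ↪ lam.ord.ToType, ∀ b c, s.rel b c → f (b.map h) = f (c.map h)

/-- `lam →_or (a, e)_mu`: the same for an ordered set `a`, with `h` order preserving. -/
def OrdArrows (lam mu : Cardinal.{u}) {a : Type} [LinearOrder a] (s : PartialIdentity a) : Prop :=
  ∀ f : Finset lam.ord.ToType → mu.ord.ToType,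
    ∃ h : a ↪o lam.ord.ToType,
      ∀ b c, s.rel b c → f (b.map h.toEmbedding) = f (c.map h.toEmbedding)

/-- `[a]²`, the family of two-element subsets of `a`. -/
abbrev Pairs (a : Type) : Type := {b : Finset a // b.card = 2}

/-- A 2-identity on `a`: an equivalence relation on `[a]²`. -/
abbrev TwoIdentity (a : Type) : Type := Setoid (Pairs a)

/-- The identity `(a, e⁺)` with `b e⁺ c ↔ b e c ∨ b = c`. -/
def TwoIdentity.plus {a : Type} (e : TwoIdentity a) : PartialIdentity a where
  dom := Set.univ
  rel b c := (∃ (hb : b.card = 2) (hc : c.card = 2), e.r ⟨b, hb⟩ ⟨c, hc⟩) ∨ b = c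
  rel_dom _ := ⟨trivial, trivial⟩
  refl _ := Or.inr rfl
  symm := by
    rintro b c (⟨hb, hc, h⟩ | rfl)
    · exact Or.inl ⟨hc, hb, e.symm' h⟩
    · exact Or.inr rfl
  trans := by
    rintro b c d (⟨hb, hc, h⟩ | rfl) (⟨hc', hd, h'⟩ | rfl)
    · exact Or.inl ⟨hb, hd, e.trans' h h'⟩
    · exact Or.inl ⟨hb, hc, h⟩
    · exact Or.inl ⟨hc', hd, h'⟩
    · exact Or.inr rfl
  card_eq := by
    rintro b c (⟨hb, hc, -⟩ | rfl)
    · rw [hb, hc]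
    · rfl

/-- `ID₂(lam, mu)`, as a set of 2-identities on the sets `{0, …, N - 1}`. -/
def ID₂ (lam mu : Cardinal.{u}) : Set (Σ N : ℕ, TwoIdentity (Fin N)) :=
  {s | Arrows lam mu s.2.plus}

/-- `OID₂(lam, mu)`, the order version of `ID₂(lam, mu)`. -/
def OID₂ (lam mu : Cardinal.{u}) : Set (Σ N : ℕ, TwoIdentity (Fin N)) :=
  {s | OrdArrows lam mu s.2.plus}

/-- The equivalence relation on `[a]²` whose non-singleton classes are those members of a family
`C` of pairwise disjoint sets which are not singletons. -/
@[reducible] def ofClasses {a ι : Type} (C : ι → Set (Pairs a))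
    (hC : ∀ i j b, b ∈ C i → b ∈ C j → i = j) : TwoIdentity a where
  r b c := b = c ∨ ∃ i, b ∈ C i ∧ c ∈ C i
  iseqv :=
    { refl := fun _ => Or.inl rfl
      symm := by
        rintro b c (rfl | ⟨i, hb, hc⟩)
        · exact Or.inl rfl
        · exact Or.inr ⟨i, hc, hb⟩
      trans := by
        rintro b c d (rfl | ⟨i, hb, hc⟩) (rfl | ⟨j, hc', hd⟩)
        · exact Or.inl rfl
        · exact Or.inr ⟨j, hc', hd⟩
        · exact Or.inr ⟨i, hb, hc⟩
        · obtain rfl := hC _ _ _ hc hc'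
          exact Or.inr ⟨i, hb, hd⟩ }

/-- The pair `b ⊆ {0, …, N - 1}` is the set `{x, y}` of natural numbers. -/
def IsPair {N : ℕ} (b : Pairs (Fin N)) (x y : ℕ) : Prop :=
  b.1.image Fin.val = {x, y}

theorem IsPair.eq_of_lt {N : ℕ} {b : Pairs (Fin N)} {x y x' y' M : ℕ} (h : IsPair b x y)
    (h' : IsPair b x' y') (hx : x < M) (hy : M ≤ y) (hx' : x' < M) (hy' : M ≤ y') :
    x = x' ∧ y = y' := by
  unfold IsPair at h h'
  rw [h] at h'
  have h1 : x ∈ ({x', y'} : Finset ℕ) := h' ▸ by simp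
  have h2 : y ∈ ({x', y'} : Finset ℕ) := h' ▸ by simp
  simp only [Finset.mem_insert, Finset.mem_singleton] at h1 h2
  omega

/-- The two classes `{{l₀, 2n + n l₀ + l₁} : l₀, l₁ < n}` (for `i = 0`) and
`{{n + l₁, 2n + n l₀ + l₁} : l₀, l₁ < n}` (for `i = 1`). -/
def sPrimeClass (n : ℕ) (i : Fin 2) : Set (Pairs (Fin (2 * n + n ^ 2))) :=
  {b | ∃ l₀ l₁ : ℕ, l₀ < n ∧ l₁ < n ∧ IsPair b (![l₀, n + l₁] i) (2 * n + n * l₀ + l₁)}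

theorem sPrimeClass_disjoint (n : ℕ) (i j : Fin 2) (b : Pairs (Fin (2 * n + n ^ 2)))
    (hi : b ∈ sPrimeClass n i) (hj : b ∈ sPrimeClass n j) : i = j := by
  obtain ⟨l₀, l₁, h0, h1, h⟩ := hi
  obtain ⟨k₀, k₁, g0, g1, g⟩ := hj
  have key := (h.eq_of_lt g (M := 2 * n)
    (by fin_cases i <;> simp <;> omega) (by omega)
    (by fin_cases j <;> simp <;> omega) (by omega)).1
  fin_cases i <;> fin_cases j <;> simp at key ⊢ <;> omega

/-- The 2-identity `s'_n` on `2n + n²` points. -/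
def sPrime (n : ℕ) : Σ N : ℕ, TwoIdentity (Fin N) :=
  ⟨2 * n + n ^ 2, ofClasses (sPrimeClass n) (sPrimeClass_disjoint n)⟩

/-- The position of the binary sequence `ν` in the lexicographic order: the number whose binary
digits, the most significant one first, are `ν 0, …, ν (n - 1)`. -/
def lexNumber {n : ℕ} (ν : Fin n → Fin 2) : ℕ :=
  ∑ j : Fin n, (ν j : ℕ) * 2 ^ (n - 1 - (j : ℕ))

theorem lexNumber_eq {n : ℕ} (ν : Fin n → Fin 2) :
    lexNumber ν = (finFunctionFinEquiv (fun j => ν j.rev) : ℕ) := by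
  rw [finFunctionFinEquiv_apply, lexNumber, ← Equiv.sum_comp Fin.revPerm]
  refine Finset.sum_congr rfl fun j _ => ?_
  have : n - 1 - ((Fin.revPerm j : Fin n) : ℕ) = j := by
    simp only [Fin.revPerm_apply, Fin.val_rev]; omega
  rw [this]; rfl

theorem lexNumber_lt {n : ℕ} (ν : Fin n → Fin 2) : lexNumber ν < 2 ^ n := by
  rw [lexNumber_eq]; exact Fin.isLt _

theorem lexNumber_injective {n : ℕ} {ν ν' : Fin n → Fin 2} (h : lexNumber ν = lexNumber ν') :
    ν = ν' := by
  rw [lexNumber_eq, lexNumber_eq] at h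
  have := finFunctionFinEquiv.injective (Fin.ext h)
  funext j
  simpa using congrFun this j.rev

/-- `η ⌢ ⟨d⟩` is an initial segment of `ν`, for `η` of length `m < n`. -/
def ExtendsBy {n : ℕ} {m : Fin n} (η : Fin (m : ℕ) → Fin 2) (d : Fin 2) (ν : Fin n → Fin 2) :
    Prop :=
  (∀ j : Fin (m : ℕ), ν (j.castLE m.isLt.le) = η j) ∧ ν m = d

/-- The class `a^i_η = {{l_i, 2^n + 2^n l₀ + l₁} : …}`, where `l₀`, `l₁` range over the numbers of
the sequences `ν₀`, `ν₁` of length `n` extending `η ⌢ ⟨0⟩` and `η ⌢ ⟨1⟩` respectively; the index is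
`((m, η), i)` with `m < n`, `η` a binary sequence of length `m`, and `i < 2`. -/
def sDoublePrimeClass (n : ℕ) (p : (Σ m : Fin n, (Fin (m : ℕ) → Fin 2)) × Fin 2) :
    Set (Pairs (Fin (2 ^ n + 2 ^ (2 * n)))) :=
  {b | ∃ ν₀ ν₁ : Fin n → Fin 2, ExtendsBy p.1.2 0 ν₀ ∧ ExtendsBy p.1.2 1 ν₁ ∧
    IsPair b (![lexNumber ν₀, lexNumber ν₁] p.2) (2 ^ n + 2 ^ n * lexNumber ν₀ + lexNumber ν₁)}

theorem ExtendsBy.unique {n : ℕ} {m m' : Fin n} {η : Fin (m : ℕ) → Fin 2}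
    {η' : Fin (m' : ℕ) → Fin 2} {ν₀ ν₁ : Fin n → Fin 2} (h0 : ExtendsBy η 0 ν₀)
    (h1 : ExtendsBy η 1 ν₁) (h0' : ExtendsBy η' 0 ν₀) (h1' : ExtendsBy η' 1 ν₁) :
    (⟨m, η⟩ : Σ m : Fin n, (Fin (m : ℕ) → Fin 2)) = ⟨m', η'⟩ := by
  have aux : ∀ {k k' : Fin n} {ζ : Fin (k : ℕ) → Fin 2} {ζ' : Fin (k' : ℕ) → Fin 2},
      ExtendsBy ζ 0 ν₀ → ExtendsBy ζ 1 ν₁ → ExtendsBy ζ' 0 ν₀ → ExtendsBy ζ' 1 ν₁ → ¬ k < k' := by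
    intro k k' ζ ζ' a0 a1 b0 b1 hlt
    have e0 := b0.1 ⟨k, hlt⟩
    have e1 := b1.1 ⟨k, hlt⟩
    have c0 : ν₀ k = 0 := a0.2
    have c1 : ν₁ k = 1 := a1.2
    have c0' : ν₀ k = ζ' ⟨k, hlt⟩ := e0
    have c1' : ν₁ k = ζ' ⟨k, hlt⟩ := e1
    rw [c0] at c0'
    rw [c1, ← c0'] at c1'
    exact absurd c1' (by decide)
  obtain rfl : m = m' :=
    le_antisymm (not_lt.1 (aux h0' h1' h0 h1)) (not_lt.1 (aux h0 h1 h0' h1'))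
  have : η = η' := funext fun j => (h0.1 j).symm.trans (h0'.1 j)
  rw [this]

theorem sDoublePrimeClass_disjoint (n : ℕ)
    (p q : (Σ m : Fin n, (Fin (m : ℕ) → Fin 2)) × Fin 2)
    (b : Pairs (Fin (2 ^ n + 2 ^ (2 * n))))
    (hp : b ∈ sDoublePrimeClass n p) (hq : b ∈ sDoublePrimeClass n q) : p = q := by
  obtain ⟨⟨m, η⟩, i⟩ := p
  obtain ⟨⟨m', η'⟩, i'⟩ := q
  obtain ⟨ν₀, ν₁, h0, h1, h⟩ := hp
  obtain ⟨μ₀, μ₁, g0, g1, g⟩ := hq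
  dsimp only at h0 h1 h g0 g1 g
  have L0 := lexNumber_lt ν₀
  have L1 := lexNumber_lt ν₁
  have M0 := lexNumber_lt μ₀
  have M1 := lexNumber_lt μ₁
  obtain ⟨k1, k2⟩ := h.eq_of_lt g (M := 2 ^ n)
    (by fin_cases i <;> simpa) (by rw [add_assoc]; exact Nat.le_add_right _ _)
    (by fin_cases i' <;> simpa) (by rw [add_assoc]; exact Nat.le_add_right _ _)
  have hpos : 0 < 2 ^ n := by positivity
  have k3 : 2 ^ n * lexNumber ν₀ + lexNumber ν₁ = 2 ^ n * lexNumber μ₀ + lexNumber μ₁ := by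
    omega
  have e0 : lexNumber ν₀ = lexNumber μ₀ := by
    have := congrArg (· / 2 ^ n) k3
    simpa [Nat.mul_add_div hpos, Nat.div_eq_of_lt L1, Nat.div_eq_of_lt M1] using this
  have e1 : lexNumber ν₁ = lexNumber μ₁ := by
    rw [e0] at k3; omega
  obtain rfl := lexNumber_injective e0
  obtain rfl := lexNumber_injective e1
  have hne : lexNumber ν₀ ≠ lexNumber ν₁ := by
    intro he
    have hν := lexNumber_injective he
    have c0 : ν₀ m = 0 := h0.2
    have c1 : ν₁ m = 1 := h1.2
    rw [hν, c1] at c0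
    exact absurd c0 (by decide)
  have hi : i = i' := by
    fin_cases i <;> fin_cases i' <;> simp at k1 ⊢
    · exact hne k1
    · exact hne k1.symm
  rw [ExtendsBy.unique h0 h1 g0 g1, hi]

/-- The 2-identity `s''_n` on `2^n + 2^(2n)` points. -/
def sDoublePrime (n : ℕ) : Σ N : ℕ, TwoIdentity (Fin N) :=
  ⟨2 ^ n + 2 ^ (2 * n), ofClasses (sDoublePrimeClass n) (sDoublePrimeClass_disjoint n)⟩

/-- A (strongly) compact cardinal: an uncountable regular cardinal `θ` such that every proper
`θ`-complete filter on any set extends to a `θ`-complete ultrafilter. -/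
def IsCompactCardinal (θ : Cardinal.{u}) : Prop :=
  ℵ₀ < θ ∧ θ.IsRegular ∧
    ∀ (X : Type u) (F : Filter X), F.NeBot → CardinalInterFilter F θ →
      ∃ D : Ultrafilter X, (D : Filter X) ≤ F ∧ CardinalInterFilter (D : Filter X) θ

end CardinalIdentity

namespace CardinalIdentity

variable {μ θ : Cardinal.{u}}

/-! Positive part. Extend the filter of tails of `μ⁺` to a `θ`-complete ultrafilter `D`. As `cf μ <
θ`, for each `α` the colours `f {α, β}` are bounded below `μ` for `D`-almost all `β`, by a member `t
α` of a fixed cofinal set of size `cf μ`; on a set `A` of more than `μ` points the bound is a single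
`t₀`. So fewer than `μ` colours matter on `A`, and each pair `α, α'` in `A` has a pair of colours `g
α α'` realised by `f {α, β}`, `f {α', β}` for unboundedly many `β`. Now `g` uses at most `κ < μ`
colours, and `exists_homogeneous_tree` finds a binary tree of height `n` on which `g` depends only
on the splitting node. It needs only more than `κ^{+n}` points, which is why `μ` may be any limit
cardinal. The remaining points of the identity are chosen above the tree, one by one, from the
unbounded sets (`exists_strictMono_extension`).

Negative part. Both identities contain, for `n ≥ 2`, points `a i`, `b j`, `c i j` (`i, j < 2`) where
all `{a i, c i j}` are equivalent and all `{b j, c i j}` are equivalent.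
`exists_coherent_filtration` writes each initial segment of `ω₁` as an increasing union of finite
sets `G k β` with `G k α = G k β ∩ Iic α` whenever `α ∈ G k β`. Hence the size of `G k x` (the level
of `x`) determines `x` inside any `G k β`. A colour recording a stage, the levels of both points and
a finite table of levels below the upper point excludes the pattern (`exists_colouring_omitting`).
-/

/-! ### Pigeonhole and homogeneous binary trees -/

theorem exists_lt_mk_preimage {α β : Type u} (f : α → β) {κ : Cardinal.{u}} (hκ : ℵ₀ ≤ κ)
    (hβ : #β ≤ κ) (hα : κ < #α) : ∃ b, κ < #(f ⁻¹' {b}) := by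
  by_contra! h
  refine hα.not_ge ((mk_le_mk_mul_of_mk_preimage_le f h).trans ?_)
  exact (mul_le_mul_left hβ κ).trans (mul_eq_self hκ).le

/-- A subset of a well-order of size more than `κ` splits into an initial part of size `κ` and a
remainder of size more than `κ`. -/
theorem exists_split {Λ : Type u} [LinearOrder Λ] [WellFoundedLT Λ] {S : Set Λ}
    {κ : Cardinal.{u}} (hκ : ℵ₀ ≤ κ) (hS : κ < #S) :
    ∃ S₀ ⊆ S, ∃ S₁ ⊆ S, #S₀ = κ ∧ κ < #S₁ ∧ ∀ x ∈ S₀, ∀ y ∈ S₁, x < y := by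
  have hlt : κ.ord < Ordinal.type (α := S) (· < ·) :=
    (ord_lt_ord.2 hS).trans_le (ord_le_type _)
  set x : S := Ordinal.enum (α := S) (· < ·) ⟨κ.ord, hlt⟩ with hx
  have hcard : #{y : S // y < x} = κ := by
    rw [← Ordinal.card_typein (r := (· < · : S → S → Prop)), hx, Ordinal.typein_enum, card_ord]
  refine ⟨Subtype.val '' {y : S | y < x}, by simp, Subtype.val '' {y : S | y < x}ᶜ, by simp,
    ?_, ?_, ?_⟩
  · rw [mk_image_eq Subtype.val_injective]
    exact hcard
  · rw [mk_image_eq Subtype.val_injective]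
    by_contra! h
    refine hS.not_ge ?_
    rw [← mk_sum_compl {y : S | y < x}]
    exact (add_le_add hcard.le h).trans (add_eq_self hκ).le
  · rintro _ ⟨y, hy, rfl⟩ _ ⟨z, hz, rfl⟩
    exact Subtype.coe_lt_coe.2 (lt_of_lt_of_le hy (not_lt.1 hz))

theorem extendsBy_zero {n : ℕ} {hk : 0 < n + 1} {η : Fin 0 → Fin 2} {d : Fin 2}
    {ν : Fin (n + 1) → Fin 2} : ExtendsBy (m := ⟨0, hk⟩) η d ν ↔ ν 0 = d :=
  ⟨fun h => h.2, fun h => ⟨fun j => j.elim0, h⟩⟩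

theorem extendsBy_succ {n k : ℕ} {hk : k + 1 < n + 1} {η : Fin (k + 1) → Fin 2} {d : Fin 2}
    {ν : Fin (n + 1) → Fin 2} : ExtendsBy (m := ⟨k + 1, hk⟩) η d ν ↔
      ν 0 = η 0 ∧ ExtendsBy (m := ⟨k, Nat.lt_of_succ_lt_succ hk⟩) (Fin.tail η) d (Fin.tail ν) := by
  constructor
  · rintro ⟨h, h'⟩
    exact ⟨h 0, fun j => h j.succ, h'⟩
  · rintro ⟨h0, h, h'⟩
    refine ⟨fun j => ?_, h'⟩
    induction j using Fin.cases with
    | zero => exact h0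
    | succ j => exact h j

/-- A colouring of the pairs of a large well-ordered set is, on some increasing copy of the binary
sequences of length `n`, a function of the longest common initial segment. -/
theorem exists_homogeneous_tree {Λ C : Type u} [LinearOrder Λ] [WellFoundedLT Λ] (g : Λ → Λ → C)
    {κ : Cardinal.{u}} (hκ : ℵ₀ ≤ κ) (hC : #C ≤ κ) (n : ℕ) (S : Set Λ)
    (hS : Order.succ^[n] κ < #S) :
    ∃ h : (Fin n → Fin 2) → Λ, (∀ ν, h ν ∈ S) ∧
      ∀ (m : Fin n) (η : Fin (m : ℕ) → Fin 2), ∃ ε : C, ∀ ν₀ ν₁, ExtendsBy η 0 ν₀ →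
        ExtendsBy η 1 ν₁ → h ν₀ < h ν₁ ∧ g (h ν₀) (h ν₁) = ε := by
  induction n generalizing S with
  | zero =>
    have : Nonempty S := by
      rw [← mk_ne_zero_iff]
      exact (pos_of_gt hS).ne'
    obtain ⟨x, hx⟩ := this
    exact ⟨fun _ => x, fun _ => hx, fun m => m.elim0⟩
  | succ n ih =>
    rw [Function.iterate_succ_apply'] at hS
    set K := Order.succ^[n] κ with hK
    have hκK : κ ≤ K := Order.le_succ_iterate _ _
    have hKs : K ≤ Order.succ K := Order.le_succ K
    -- The left half of the tree will lie in `S₀`, of size exactly `K⁺`: large enough that some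
    -- fibre of `g · y` exceeds `K`, small enough that there are only `K⁺` candidate left halves.
    obtain ⟨S₀, hS₀, S₁, hS₁, c0, c1, hlt⟩ := exists_split ((hκ.trans hκK).trans hKs) hS
    have key : ∀ y : S₁, ∃ p : ((Fin n → Fin 2) → S₀) × C, (∀ ν, g (p.1 ν) y = p.2) ∧
        ∀ (m : Fin n) (η : Fin (m : ℕ) → Fin 2), ∃ ε : C, ∀ ν₀ ν₁, ExtendsBy η 0 ν₀ →
          ExtendsBy η 1 ν₁ → (p.1 ν₀ : Λ) < p.1 ν₁ ∧ g (p.1 ν₀) (p.1 ν₁) = ε := by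
      intro y
      obtain ⟨ε, hε⟩ := exists_lt_mk_preimage (fun x : S₀ => g x y) (hκ.trans hκK)
        (hC.trans hκK) (by rw [c0]; exact Order.lt_succ K)
      obtain ⟨h, hh, H⟩ := ih (Subtype.val '' ((fun x : S₀ => g x y) ⁻¹' {ε})) (by
        rwa [mk_image_eq Subtype.val_injective])
      choose x hx hxh using hh
      refine ⟨⟨x, ε⟩, hx, ?_⟩
      simpa only [hxh] using H
    choose p hp hpt using key
    -- More than `K⁺` points `y` share the same left half `T` and the same colour `ε`; the right
    -- half is then found among these `y`.
    obtain ⟨⟨T, ε⟩, hq⟩ := exists_lt_mk_preimage p ((hκ.trans hκK).trans hKs) (by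
      have hK' : ℵ₀ ≤ Order.succ K := (hκ.trans hκK).trans hKs
      have h1 : #((Fin n → Fin 2) → S₀) ≤ Order.succ K := by
        have := power_nat_le (n := Fintype.card (Fin n → Fin 2)) hK'
        rwa [mk_arrow, mk_fintype (Fin n → Fin 2), lift_uzero, lift_natCast, c0, power_natCast]
      rw [mk_prod, lift_id, lift_id]
      exact (mul_le_mul' h1 (hC.trans (hκK.trans hKs))).trans (mul_eq_self hK').le) c1
    obtain ⟨T', hT', H'⟩ := ih (Subtype.val '' (p ⁻¹' {(T, ε)})) (by
      rw [mk_image_eq Subtype.val_injective]; exact hKs.trans_lt hq)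
    choose x hx hxT using hT'
    have hTx : ∀ ν ν', (T ν : Λ) < T' ν' ∧ g (T ν) (T' ν') = ε := by
      intro ν ν'
      rw [← hxT]
      have h1 := hp (x ν') ν
      have h2 : p (x ν') = (T, ε) := hx ν'
      rw [h2] at h1
      exact ⟨hlt _ (T ν).2 _ (x ν').2, h1⟩
    have HT := hpt (x 0)
    have h2 : p (x 0) = (T, ε) := hx 0
    rw [h2] at HT
    refine ⟨fun ν => if ν 0 = 0 then T (Fin.tail ν) else T' (Fin.tail ν), fun ν => ?_, ?_⟩
    · dsimp only
      split_ifs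
      · exact hS₀ (T _).2
      · rw [← hxT]
        exact hS₁ (x _).2
    · rintro ⟨_ | k, hk⟩ η
      · refine ⟨ε, fun ν₀ ν₁ h0 h1 => ?_⟩
        rw [extendsBy_zero] at h0 h1
        simpa [h0, h1] using hTx _ _
      · rcases (by omega : η 0 = 0 ∨ η 0 = 1) with e | e
        · obtain ⟨δ, hδ⟩ := HT ⟨k, Nat.lt_of_succ_lt_succ hk⟩ (Fin.tail η)
          refine ⟨δ, fun ν₀ ν₁ h0 h1 => ?_⟩
          rw [extendsBy_succ, e] at h0 h1
          simpa [h0.1, h1.1] using hδ _ _ h0.2 h1.2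
        · obtain ⟨δ, hδ⟩ := H' ⟨k, Nat.lt_of_succ_lt_succ hk⟩ (Fin.tail η)
          refine ⟨δ, fun ν₀ ν₁ h0 h1 => ?_⟩
          rw [extendsBy_succ, e] at h0 h1
          simpa [h0.1, h1.1] using hδ _ _ h0.2 h1.2

/-! ### Complete filters and the ultrafilter argument -/

/-- If each `p · t` failed eventually, completeness would make all of them fail together. It serves
both for the ultrafilter and for the filter of tails. -/
theorem frequently_pigeonhole {X T : Type u} {l : Filter X} {c : Cardinal.{u}}
    [CardinalInterFilter l c] (hT : #T < c) {p : X → T → Prop} (h : ∃ᶠ x in l, ∃ t, p x t) :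
    ∃ t, ∃ᶠ x in l, p x t := by
  by_contra H
  simp only [not_exists, Filter.not_frequently] at H
  refine h (((Filter.eventually_cardinal_forall hT).2 H).mono fun x hx => ?_)
  simpa using hx

/-- The starting points of fewer than `cof X` tails are not cofinal, so some point lies above all of
them. -/
theorem cardinalInterFilter_atTop {X : Type u} [LinearOrder X] [Nonempty X] {c : Cardinal.{u}}
    (hc : c ≤ Order.cof X) : CardinalInterFilter (Filter.atTop : Filter X) c where
  cardinal_sInter_mem S hS hmem := by
    choose a ha using fun s : S => Filter.mem_atTop_sets.1 (hmem s s.2)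
    have h : ¬ IsCofinal (Set.range a) := fun h =>
      (mk_range_le.trans_lt (hS.trans_le hc)).not_ge (Order.cof_le h)
    obtain ⟨x, hx⟩ := not_isCofinal_iff.1 h
    refine Filter.mem_atTop_sets.2 ⟨x, fun y hy s hs => ?_⟩
    exact ha ⟨s, hs⟩ y ((hx _ ⟨⟨s, hs⟩, rfl⟩).le.trans hy)

theorem noMaxOrder_succ (hμ : ℵ₀ ≤ μ) :
    NoMaxOrder (Order.succ μ).ord.ToType ∧ Nonempty (Order.succ μ).ord.ToType := by
  refine ⟨noMaxOrder (hμ.trans (Order.le_succ μ)), ?_⟩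
  rw [← mk_ne_zero_iff, mk_ord_toType]
  exact (pos_of_gt (Order.lt_succ μ)).ne'

/-- Every colouring has an increasing binary tree of points such that any two of them have, with
unboundedly many points, colours depending only on their longest common initial segment. -/
theorem exists_tree_frequently (hμ : Order.IsSuccLimit μ)
    (hθ : IsCompactCardinal θ) (hcof : μ.ord.cof < θ) (hlt : θ < μ)
    (f : Finset (Order.succ μ).ord.ToType → μ.ord.ToType) (n : ℕ) :
    ∃ h : (Fin n → Fin 2) → (Order.succ μ).ord.ToType,
      ∀ (m : Fin n) (η : Fin (m : ℕ) → Fin 2), ∃ ε : Fin 2 → μ.ord.ToType,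
        ∀ ν₀ ν₁, ExtendsBy η 0 ν₀ → ExtendsBy η 1 ν₁ → h ν₀ < h ν₁ ∧
          ∃ᶠ β in Filter.atTop, f {h ν₀, β} = ε 0 ∧ f {h ν₁, β} = ε 1 := by
  obtain ⟨hθ₀, -, hD⟩ := hθ
  have hμ₀ : ℵ₀ ≤ μ := (hθ₀.trans hlt).le
  have hμs : μ < Order.succ μ := Order.lt_succ μ
  have hcofΛ : Order.cof (Order.succ μ).ord.ToType = Order.succ μ := by
    rw [Ordinal.cof_toType, (isRegular_succ hμ₀).cof_ord]
  have := noMaxOrder hμ₀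
  obtain ⟨_, _⟩ := noMaxOrder_succ hμ₀
  have := cardinalInterFilter_atTop hcofΛ.ge
  obtain ⟨D, hDle, _⟩ := hD _ (Filter.atTop : Filter (Order.succ μ).ord.ToType) inferInstance
    (CardinalInterFilter.of_cardinalInterFilter_of_le _ (hlt.trans hμs).le)
  obtain ⟨T, hT, hTc⟩ := Order.exists_cof_eq (α := μ.ord.ToType)
  rw [Ordinal.cof_toType] at hTc
  have ht : ∀ α, ∃ t : T, ∀ᶠ β in D, f {α, β} ≤ t := by
    intro α
    simp only [← Ultrafilter.frequently_iff_eventually]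
    refine frequently_pigeonhole (c := θ) (hTc.trans_lt hcof) (Filter.Frequently.of_forall fun β => ?_)
    obtain ⟨t, ht, h⟩ := hT (f {α, β})
    exact ⟨⟨t, ht⟩, h⟩
  choose t ht using ht
  obtain ⟨t₀, hA⟩ := exists_lt_mk_preimage t hμ₀ (hTc.trans_lt (hcof.trans hlt)).le
    (by rwa [mk_ord_toType])
  have hlt₀ : #(Set.Iic (t₀ : μ.ord.ToType)) < μ := by
    obtain ⟨x, hx⟩ := exists_gt (t₀ : μ.ord.ToType)
    exact (mk_le_mk_of_subset (Set.Iic_subset_Iio.2 hx)).trans_lt (by simpa using mk_Iio_lt x (by simp))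
  have : Nonempty (Set.Iic (t₀ : μ.ord.ToType)) := ⟨t₀, Set.self_mem_Iic⟩
  set κ := max ℵ₀ #(Set.Iic (t₀ : μ.ord.ToType)) with hκ
  have hκ₀ : ℵ₀ ≤ κ := le_max_left _ _
  have hκμ : κ < μ := max_lt (hθ₀.trans hlt) hlt₀
  have hC : #(Set.Iic (t₀ : μ.ord.ToType) × Set.Iic (t₀ : μ.ord.ToType)) ≤ κ := by
    rw [mk_prod, lift_id]
    exact (mul_le_mul' (le_max_right _ _) (le_max_right _ _)).trans (mul_eq_self hκ₀).le
  have hit : Order.succ^[n] κ < μ := by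
    clear_value κ
    induction n with
    | zero => exact hκμ
    | succ n ih =>
      rw [Function.iterate_succ_apply']
      exact hμ.succ_lt ih
  have hg : ∀ α α', ∃ p : Set.Iic (t₀ : μ.ord.ToType) × Set.Iic (t₀ : μ.ord.ToType),
      α ∈ t ⁻¹' {t₀} → α' ∈ t ⁻¹' {t₀} →
        ∃ᶠ β in Filter.atTop, f {α, β} = p.1 ∧ f {α', β} = p.2 := by
    intro α α'
    by_cases hαα : α ∈ t ⁻¹' {t₀} ∧ α' ∈ t ⁻¹' {t₀}
    -- `D` is only known to be `θ`-complete, and `κ` may be at least `θ`. So `D` supplies only the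
    -- bound `t₀`; the pair of colours is fixed along the tails, which are `μ⁺`-complete.
    · obtain ⟨p, hp⟩ := frequently_pigeonhole (l := Filter.atTop) (hC.trans_lt (hκμ.trans hμs))
        (p := fun β p => f {α, β} = p.1 ∧ f {α', β} = p.2) (by
          have h1 := ht α
          have h2 := ht α'
          rw [show t α = t₀ from hαα.1] at h1
          rw [show t α' = t₀ from hαα.2] at h2
          refine ((h1.and h2).frequently.filter_mono hDle).mono ?_
          rintro β ⟨h1, h2⟩
          exact ⟨(⟨_, h1⟩, ⟨_, h2⟩), rfl, rfl⟩)
      exact ⟨p, fun _ _ => hp⟩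
    · exact ⟨Classical.arbitrary _, fun h h' => absurd ⟨h, h'⟩ hαα⟩
  choose g hg using hg
  obtain ⟨h, hhA, hh⟩ := exists_homogeneous_tree g hκ₀ hC n (t ⁻¹' {t₀}) (hit.trans hA)
  refine ⟨h, fun m η => ?_⟩
  obtain ⟨ε, hε⟩ := hh m η
  refine ⟨![ε.1, ε.2], fun ν₀ ν₁ h0 h1 => ?_⟩
  obtain ⟨h2, rfl⟩ := hε ν₀ ν₁ h0 h1
  exact ⟨h2, hg _ _ (hhA _) (hhA _)⟩

/-! ### Realising the identities -/

/-- An increasing sequence of length `M` extends to an increasing infinite sequence with prescribed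
unbounded sets for the further terms. -/
theorem exists_strictMono_extension {X : Type*} [LinearOrder X] [Nonempty X] {M : ℕ} {a : ℕ → X}
    (ha : StrictMonoOn a (Set.Iio M)) {U : ℕ → Set X}
    (hU : ∀ k, ∃ᶠ β in Filter.atTop, β ∈ U k) [NoMaxOrder X] :
    ∃ h : ℕ → X, StrictMono h ∧ (∀ x < M, h x = a x) ∧ ∀ k, h (M + k) ∈ U k := by
  obtain ⟨b, hb⟩ := ((Set.finite_Iio M).image a).bddAbove
  choose F hF hFU using fun k x => Filter.frequently_atTop'.1 (hU k) x
  let c : ℕ → X := fun k => Nat.rec (F 0 b) (fun k x => F (k + 1) x) k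
  have hc : StrictMono c := strictMono_nat_of_lt_succ fun k => hF (k + 1) (c k)
  have hcU : ∀ k, c k ∈ U k := fun k => by
    cases k with
    | zero => exact hFU 0 b
    | succ k => exact hFU (k + 1) (c k)
  have hbc : ∀ k, b < c k := fun k => (hF 0 b : b < c 0).trans_le (hc.monotone k.zero_le)
  refine ⟨fun x => if x < M then a x else c (x - M), fun x y hxy => ?_, fun x hx => if_pos hx,
    fun k => by simpa using hcU k⟩
  dsimp only
  split_ifs with hx hy hy
  · exact ha hx hy hxy
  · exact (hb ⟨x, hx, rfl⟩).trans_lt (hbc _)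
  · omega
  · exact hc (by omega)

theorem IsPair.map_eq {N : ℕ} {b : Pairs (Fin N)} {x y : ℕ} (hb : IsPair b x y) {X : Type*}
    [DecidableEq X] {h : ℕ → X} {e : Fin N ↪ X} (he : ∀ i : Fin N, e i = h i) :
    b.1.map e = {h x, h y} := by
  have : (b.1.image Fin.val).image h = {h x, h y} := by
    rw [show b.1.image Fin.val = {x, y} from hb]
    simp
  rw [← this, Finset.map_eq_image, Finset.image_image]
  exact Finset.image_congr fun i _ => he i

theorem lexNumber_succ {n : ℕ} (ν : Fin (n + 1) → Fin 2) :
    lexNumber ν = ν 0 * 2 ^ n + lexNumber (Fin.tail ν) := by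
  rw [lexNumber, Fin.sum_univ_succ]
  congr 1
  refine Finset.sum_congr rfl fun j _ => ?_
  congr 2
  simp only [Fin.val_succ]
  omega

/-- The splitting node is at the first digit where the sequences differ, since that digit outweighs
all later ones. It makes the homogeneous tree increasing in the lexicographic number. -/
theorem exists_extendsBy_of_lexNumber_lt {n : ℕ} {ν ν' : Fin n → Fin 2}
    (h : lexNumber ν < lexNumber ν') :
    ∃ (m : Fin n) (η : Fin (m : ℕ) → Fin 2), ExtendsBy η 0 ν ∧ ExtendsBy η 1 ν' := by
  induction n with
  | zero => simp [lexNumber] at h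
  | succ n ih =>
    have h1 := lexNumber_lt (Fin.tail ν)
    have h2 := lexNumber_lt (Fin.tail ν')
    rw [lexNumber_succ, lexNumber_succ ν'] at h
    by_cases h0 : ν 0 = ν' 0
    · rw [h0] at h
      obtain ⟨⟨k, hk⟩, η, hη, hη'⟩ := ih (Nat.lt_of_add_lt_add_left h)
      exact ⟨⟨k + 1, Nat.succ_lt_succ hk⟩, Fin.cons (ν 0) η, extendsBy_succ.2 ⟨rfl, hη⟩,
        extendsBy_succ.2 ⟨h0.symm, hη'⟩⟩
    · refine ⟨⟨0, n.succ_pos⟩, Fin.elim0, extendsBy_zero.2 ?_, extendsBy_zero.2 ?_⟩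
      · by_contra h3
        have e : ν 0 = 1 := by omega
        have e' : ν' 0 = 0 := by omega
        rw [e, e'] at h
        simp at h
        omega
      · by_contra h3
        have e : ν 0 = 1 := by omega
        have e' : ν' 0 = 0 := by omega
        rw [e, e'] at h
        simp at h
        omega

theorem exists_lexNumber_rightInverse (n : ℕ) :
    ∃ bin : ℕ → Fin n → Fin 2, ∀ x < 2 ^ n, lexNumber (bin x) = x := by
  have : ∀ x, ∃ ν : Fin n → Fin 2, x < 2 ^ n → lexNumber ν = x := fun x => by
    by_cases hx : x < 2 ^ n
    · refine ⟨fun j => finFunctionFinEquiv.symm (⟨x, hx⟩ : Fin (2 ^ n)) j.rev, fun _ => ?_⟩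
      rw [lexNumber_eq]
      simp
    · exact ⟨0, fun h => absurd h hx⟩
  exact Classical.skolem.1 this

theorem ofClasses_mem_OID₂ {lam mu : Cardinal.{u}} {N : ℕ} {ι : Type}
    {C : ι → Set (Pairs (Fin N))} {hC : ∀ i j b, b ∈ C i → b ∈ C j → i = j}
    (H : ∀ f : Finset lam.ord.ToType → mu.ord.ToType, ∃ h : ℕ → lam.ord.ToType, StrictMono h ∧
      ∀ i, ∃ ε, ∀ b ∈ C i, ∃ x y, IsPair b x y ∧ f {h x, h y} = ε) :
    (⟨N, ofClasses C hC⟩ : Σ N : ℕ, TwoIdentity (Fin N)) ∈ OID₂ lam mu := by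
  intro f
  obtain ⟨h, hmono, hh⟩ := H f
  refine ⟨OrderEmbedding.ofStrictMono (fun i : Fin N => h i) fun i j hij => hmono hij, ?_⟩
  rintro b c (⟨hb, hc, hbc | ⟨i, hbi, hci⟩⟩ | rfl)
  · rw [Subtype.mk.inj hbc]
  · obtain ⟨ε, hε⟩ := hh i
    obtain ⟨x, y, hxy, rfl⟩ := hε _ hbi
    obtain ⟨x', y', hxy', h'⟩ := hε _ hci
    have e1 := hxy.map_eq (h := h)
      (e := (OrderEmbedding.ofStrictMono (fun i : Fin N => h i) fun i j hij => hmono hij).toEmbedding)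
      fun _ => rfl
    have e2 := hxy'.map_eq (h := h)
      (e := (OrderEmbedding.ofStrictMono (fun i : Fin N => h i) fun i j hij => hmono hij).toEmbedding)
      fun _ => rfl
    rw [e1, e2, h']
  · rfl

theorem OID₂_subset_ID₂ (lam mu : Cardinal.{u}) : OID₂ lam mu ⊆ ID₂ lam mu := fun _ hs f =>
  let ⟨h, hh⟩ := hs f
  ⟨h.toEmbedding, hh⟩

/-- Only the root splitting of a tree of height `n + 1` is used: `n` of the `2 ^ n` leaves on each
side serve as the first `2n` points. -/
theorem sPrime_mem_OID₂ (hμ : Order.IsSuccLimit μ) (hθ : IsCompactCardinal θ)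
    (hcof : μ.ord.cof < θ) (hlt : θ < μ) (n : ℕ) : sPrime n ∈ OID₂ (Order.succ μ) μ := by
  refine ofClasses_mem_OID₂ fun f => ?_
  obtain ⟨_, _⟩ := noMaxOrder_succ (hθ.1.trans hlt).le
  obtain ⟨T, hT⟩ := exists_tree_frequently hμ hθ hcof hlt f (n + 1)
  have hTmono : ∀ ν ν', lexNumber ν < lexNumber ν' → T ν < T ν' := fun ν ν' h => by
    obtain ⟨m, η, h0, h1⟩ := exists_extendsBy_of_lexNumber_lt h
    exact ((hT m η).choose_spec ν ν' h0 h1).1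
  obtain ⟨ε, hε⟩ := hT ⟨0, n.succ_pos⟩ Fin.elim0
  simp only [extendsBy_zero] at hε
  obtain ⟨bin, hbin⟩ := exists_lexNumber_rightInverse n
  have hn : n < 2 ^ n := Nat.lt_two_pow_self
  have hlex : ∀ (d : Fin 2) (x : ℕ), x < n →
      lexNumber (Fin.cons d (bin x) : Fin (n + 1) → Fin 2) = d * 2 ^ n + x := fun d x hx => by
    rw [lexNumber_succ, Fin.tail_cons, hbin x (hx.trans hn), Fin.cons_zero]
  obtain ⟨h, hmono, ha, hU⟩ := exists_strictMono_extension (M := 2 * n)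
    (a := fun x => if x < n then T (Fin.cons 0 (bin x)) else T (Fin.cons 1 (bin (x - n))))
    (U := fun k => {β | f {T (Fin.cons 0 (bin (k / n))), β} = ε 0 ∧
      f {T (Fin.cons 1 (bin (k % n))), β} = ε 1})
    (by
      intro x hx y hy hxy
      simp only [Set.mem_Iio] at hx hy
      dsimp only
      split_ifs with hxn hyn hyn
      · exact hTmono _ _ (by rw [hlex 0 x hxn, hlex 0 y hyn]; simpa using hxy)
      · exact hTmono _ _ (by rw [hlex 0 x hxn, hlex 1 (y - n) (by omega)]; simp; omega)
      · omega
      · exact hTmono _ _ (by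
          rw [hlex 1 (x - n) (by omega), hlex 1 (y - n) (by omega)]; simp; omega))
    (fun k => (hε _ _ rfl rfl).2)
  refine ⟨h, hmono, fun i => ⟨ε i, ?_⟩⟩
  rintro b ⟨l₀, l₁, h0, h1, hb⟩
  refine ⟨_, _, hb, ?_⟩
  have hk := hU (n * l₀ + l₁)
  rw [← add_assoc] at hk
  have e1 : (n * l₀ + l₁) / n = l₀ := by
    rw [Nat.mul_add_div (by omega), Nat.div_eq_of_lt h1, add_zero]
  have e2 : (n * l₀ + l₁) % n = l₁ := by
    rw [Nat.mul_add_mod, Nat.mod_eq_of_lt h1]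
  rw [Set.mem_ofPred_eq, e1, e2] at hk
  fin_cases i
  · have := ha l₀ (by omega)
    simpa [this, h0] using hk.1
  · have := ha (n + l₁) (by omega)
    simpa [this] using hk.2

theorem sDoublePrime_mem_OID₂ (hμ : Order.IsSuccLimit μ) (hθ : IsCompactCardinal θ)
    (hcof : μ.ord.cof < θ) (hlt : θ < μ) (n : ℕ) : sDoublePrime n ∈ OID₂ (Order.succ μ) μ := by
  refine ofClasses_mem_OID₂ fun f => ?_
  obtain ⟨_, _⟩ := noMaxOrder_succ (hθ.1.trans hlt).le
  obtain ⟨T, hT⟩ := exists_tree_frequently hμ hθ hcof hlt f n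
  choose ε hε using hT
  obtain ⟨bin, hbin⟩ := exists_lexNumber_rightInverse n
  have hbin' : ∀ ν, bin (lexNumber ν) = ν := fun ν =>
    lexNumber_injective (hbin _ (lexNumber_lt ν))
  obtain ⟨h, hmono, ha, hU⟩ := exists_strictMono_extension (M := 2 ^ n) (a := fun x => T (bin x))
    -- The quotient and remainder of `k` by `2 ^ n` decode the two leaves. At most one `(m, η)`
    -- splits them in this order; if none does, the set is everything.
    (U := fun k => {β | ∀ (m : Fin n) (η : Fin (m : ℕ) → Fin 2),
      ExtendsBy η 0 (bin (k / 2 ^ n)) → ExtendsBy η 1 (bin (k % 2 ^ n)) →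
        f {T (bin (k / 2 ^ n)), β} = ε m η 0 ∧ f {T (bin (k % 2 ^ n)), β} = ε m η 1})
    (by
      intro x hx y hy hxy
      obtain ⟨m, η, h0, h1⟩ := exists_extendsBy_of_lexNumber_lt
        (show lexNumber (bin x) < lexNumber (bin y) by rwa [hbin x hx, hbin y hy])
      exact (hε m η _ _ h0 h1).1)
    (fun k => by
      by_cases hk : ∃ (m : Fin n) (η : Fin (m : ℕ) → Fin 2),
          ExtendsBy η 0 (bin (k / 2 ^ n)) ∧ ExtendsBy η 1 (bin (k % 2 ^ n))
      · obtain ⟨m, η, h0, h1⟩ := hk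
        refine (hε m η _ _ h0 h1).2.mono fun β hβ m' η' h0' h1' => ?_
        cases ExtendsBy.unique h0 h1 h0' h1'
        exact hβ
      · exact Filter.Frequently.of_forall fun β m η h0 h1 => absurd ⟨m, η, h0, h1⟩ hk)
  refine ⟨h, hmono, fun ⟨⟨m, η⟩, i⟩ => ⟨ε m η i, ?_⟩⟩
  rintro b ⟨ν₀, ν₁, h0, h1, hb⟩
  refine ⟨_, _, hb, ?_⟩
  have hk := hU (2 ^ n * lexNumber ν₀ + lexNumber ν₁)
  rw [← add_assoc] at hk
  have e1 : (2 ^ n * lexNumber ν₀ + lexNumber ν₁) / 2 ^ n = lexNumber ν₀ := by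
    rw [Nat.mul_add_div (by positivity), Nat.div_eq_of_lt (lexNumber_lt _), add_zero]
  have e2 : (2 ^ n * lexNumber ν₀ + lexNumber ν₁) % 2 ^ n = lexNumber ν₁ := by
    rw [Nat.mul_add_mod, Nat.mod_eq_of_lt (lexNumber_lt _)]
  rw [Set.mem_ofPred_eq, e1, e2, hbin', hbin'] at hk
  have a0 := ha _ (lexNumber_lt ν₀)
  have a1 := ha _ (lexNumber_lt ν₁)
  rw [hbin'] at a0 a1
  fin_cases i
  · simpa [a0] using (hk m η h0 h1).1
  · simpa [a1] using (hk m η h0 h1).2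

/-! ### Coherent finite filtrations -/

/-- In a linear order with countable initial segments, a monotone sequence below `β` which is
cofinal there, whenever `β` is not minimal. -/
theorem exists_ladder {X : Type u} [LinearOrder X] (hX : ∀ β : X, (Set.Iio β).Countable) :
    ∃ b : X → ℕ → X, (∀ β, Monotone (b β)) ∧ ∀ β, ¬ IsMin β →
      (∀ j, b β j < β) ∧ ∀ α < β, ∃ j, α ≤ b β j := by
  have : ∀ β : X, ∃ b : ℕ → X, Monotone b ∧ (¬ IsMin β →
      (∀ j, b j < β) ∧ ∀ α < β, ∃ j, α ≤ b j) := by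
    intro β
    by_cases hβ : IsMin β
    · exact ⟨fun _ => β, monotone_const, fun h => absurd hβ h⟩
    obtain ⟨e, he⟩ := (hX β).exists_eq_range (not_isMin_iff.1 hβ)
    refine ⟨partialSups e, (partialSups e).monotone, fun _ => ⟨fun j => ?_, fun α hα => ?_⟩⟩
    · rw [partialSups_eq_sup'_range, Finset.sup'_lt_iff]
      exact fun i _ => he.ge ⟨i, rfl⟩
    · obtain ⟨j, rfl⟩ := he.le hα
      exact ⟨j, le_partialSups e j⟩
  choose b hb using this
  exact ⟨b, fun β => (hb β).1, fun β => (hb β).2⟩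

open Classical in
/-- The part of the coherent filtration below a point, along the ladders `b`. -/
noncomputable def filtration {X : Type u} [LinearOrder X] [WellFoundedLT X] (b : X → ℕ → X)
    (hb : ∀ β, ¬ IsMin β → ∀ j, b β j < β) (k : ℕ) (β : X) : Set X :=
  if h : IsMin β then {β} else
    -- Climb the ladder to the last rung, of index at most `k`, such that each rung before it lies
    -- in the stage-`k` set of the next. The cap by `k` makes the maximum exist; index `0` always
    -- qualifies.
    insert β (filtration b hb k (b β (Nat.findGreatest
      (fun n => ∀ j < n, b β j ∈ filtration b hb k (b β (j + 1))) k)))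
termination_by (wellFounded_lt (α := X)).wrap β
decreasing_by all_goals exact hb β h _

/-- A coherent filtration of the initial segments of a well-order with countable initial segments
by finite sets. -/
theorem exists_coherent_filtration {X : Type u} [LinearOrder X] [WellFoundedLT X]
    (hX : ∀ β : X, (Set.Iio β).Countable) :
    ∃ G : ℕ → X → Set X, (∀ k β, (G k β).Finite) ∧ (∀ k β, G k β ⊆ Set.Iic β) ∧
      (∀ k β, β ∈ G k β) ∧ (∀ β, Monotone fun k => G k β) ∧
      (∀ α β, α ≤ β → ∃ k, α ∈ G k β) ∧
      ∀ k α β, α ∈ G k β → G k α = G k β ∩ Set.Iic α := by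
  classical
  obtain ⟨b, hmono, hb⟩ := exists_ladder hX
  have hlt := fun β h => (hb β h).1
  set G := filtration b hlt with hG
  let N : ℕ → X → ℕ := fun k β => Nat.findGreatest
      (fun n => ∀ j < n, b β j ∈ G k (b β (j + 1))) k
  have hmin : ∀ k β, IsMin β → G k β = {β} := fun k β h => by
    rw [hG, filtration, dif_pos h]
  have hstep : ∀ k β, ¬ IsMin β → G k β = insert β (G k (b β (N k β))) := fun k β h => by
    rw [hG, filtration, dif_neg h]
  have hN : ∀ k β, ∀ j < N k β, b β j ∈ G k (b β (j + 1)) := fun k β =>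
    Nat.findGreatest_spec (P := fun n => ∀ j < n, b β j ∈ G k (b β (j + 1))) (Nat.zero_le k)
      (by simp)
  have hself : ∀ k β, β ∈ G k β := fun k β => by
    by_cases h : IsMin β
    · simp [hmin k β h]
    · simp [hstep k β h]
  have hfin : ∀ k β, (G k β).Finite := fun k β => by
    induction β using WellFoundedLT.induction with
    | ind β ih =>
      by_cases h : IsMin β
      · simp [hmin k β h]
      · rw [hstep k β h]
        exact (ih _ (hlt β h _)).insert β
  have hIic : ∀ k β, G k β ⊆ Set.Iic β := fun k β => by
    induction β using WellFoundedLT.induction with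
    | ind β ih =>
      by_cases h : IsMin β
      · simp [hmin k β h]
      · rw [hstep k β h]
        refine Set.insert_subset Set.self_mem_Iic ((ih _ (hlt β h _)).trans ?_)
        exact Set.Iic_subset_Iic.2 (hlt β h _).le
  have hcoh : ∀ k α β, α ∈ G k β → G k α = G k β ∩ Set.Iic α := fun k α β => by
    induction β using WellFoundedLT.induction with
    | ind β ih =>
      intro hα
      by_cases h : IsMin β
      · rw [hmin k β h] at hα ⊢
        obtain rfl : α = β := hα
        rw [hmin k α h]
        simp
      · rw [hstep k β h] at hα ⊢
        rcases hα with rfl | hα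
        · rw [Set.inter_eq_left.2]
          · exact hstep k α h
          · rw [← hstep k α h]
            exact hIic k α
        · rw [ih _ (hlt β h _) hα, Set.insert_inter_of_notMem]
          simpa using (hIic k _ hα : α ≤ _).trans_lt (hlt β h _)
  have hchain : ∀ k β n, (∀ j < n, b β j ∈ G k (b β (j + 1))) → ∀ j ≤ n, b β j ∈ G k (b β n) := by
    intro k β n
    induction n with
    | zero =>
      intro _ j hj
      rw [Nat.le_zero.1 hj]
      exact hself _ _
    | succ n ih =>
      intro h j hj
      rcases hj.eq_or_lt with rfl | hj
      · exact hself _ _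
      · have h1 := ih (fun j hj => h j (hj.trans n.lt_succ_self)) j (Nat.le_of_lt_succ hj)
        rw [hcoh _ _ _ (h n n.lt_succ_self)] at h1
        exact h1.1
  have hkmono : ∀ β, Monotone fun k => G k β := fun β => by
    induction β using WellFoundedLT.induction with
    | ind β ih =>
      intro k k' hk
      dsimp only
      by_cases h : IsMin β
      · rw [hmin k β h, hmin k' β h]
      · rw [hstep k β h, hstep k' β h]
        refine Set.insert_subset_insert ?_
        -- By induction, a chain of rungs valid at stage `k` stays valid at stage `k'`, so the climb
        -- only gets higher.
        have hNN : N k β ≤ N k' β := Nat.le_findGreatest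
          ((Nat.findGreatest_le k).trans hk) fun j hj => ih _ (hlt β h _) hk (hN k β j hj)
        have h1 : b β (N k β) ∈ G k' (b β (N k' β)) := hchain k' β _ (hN k' β) _ hNN
        refine (ih _ (hlt β h (N k β)) hk).trans ?_
        dsimp only
        rw [hcoh _ _ _ h1]
        exact Set.inter_subset_left
  refine ⟨G, hfin, hIic, hself, hkmono, fun α β => ?_, hcoh⟩
  induction β using WellFoundedLT.induction generalizing α with
  | ind β ih =>
    intro hαβ
    rcases hαβ.eq_or_lt with rfl | hαβ
    · exact ⟨0, hself _ _⟩
    have h : ¬ IsMin β := fun h => h.not_lt hαβ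
    obtain ⟨n, hn⟩ := (hb β h).2 α hαβ
    obtain ⟨k₀, hk₀⟩ := ih _ (hlt β h n) α hn
    choose κ hκ using fun j => ih (b β (j + 1)) (hlt β h _) (b β j) (hmono β j.le_succ)
    set K := (Finset.range n).sup κ ⊔ n ⊔ k₀
    -- `K` bounds `n`, the stages linking the first `n` rungs, and the stage at which `α` appears
    -- below rung `n`.
    have hKN : n ≤ N K β := Nat.le_findGreatest (le_sup_right.trans le_sup_left) fun j hj =>
      hkmono _ (((Finset.le_sup (f := κ) (Finset.mem_range.2 hj)).trans le_sup_left).trans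
        le_sup_left) (hκ j)
    refine ⟨K, ?_⟩
    have h1 : b β n ∈ G K (b β (N K β)) := hchain K β _ (hN K β) _ hKN
    have h2 : α ∈ G K (b β n) := hkmono _ le_sup_right hk₀
    rw [hcoh _ _ _ h1] at h2
    rw [hstep K β h]
    exact Set.mem_insert_of_mem _ h2.1

/-! ### The colouring omitting the pattern -/

/-- A colouring of the pairs of a well-order with countable initial segments by countably many
colours which omits the pattern common to `s'_2` and `s''_2`. -/
theorem exists_colouring_omitting {X : Type u} [LinearOrder X] [WellFoundedLT X]
    (hX : ∀ β : X, (Set.Iio β).Countable) :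
    ∃ F : X → X → ℕ, (∀ x y, F x y = F y x) ∧ ∀ (a b : Fin 2 → X) (c : Fin 2 → Fin 2 → X) (ε δ : ℕ),
      a.Injective → b.Injective → (∀ i j, a i ≠ b j) → (∀ i, (c i).Injective) →
      (∀ j, Function.Injective fun i => c i j) → (∀ i j, a i ≠ c i j) → (∀ i j, b j ≠ c i j) →
      (∀ i j, F (a i) (c i j) = ε) → (∀ i j, F (b j) (c i j) = δ) → False := by
  classical
  obtain ⟨G, hfin, hIic, hself, hkmono, hex, hcoh⟩ := exists_coherent_filtration hX
  let lev : ℕ → X → ℕ := fun k x => (G k x).ncard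
  have hρ : ∀ α β, ∃ k, α ≤ β → α ∈ G k β := fun α β => by
    by_cases h : α ≤ β
    · exact (hex α β h).imp fun k hk _ => hk
    · exact ⟨0, fun h' => absurd h' h⟩
  choose ρ hρ using hρ
  -- The table links the level of `x` at its own stage `ρ x β` with its level at stage `k`, so
  -- levels at two different stages can be compared through the colour. Here `ρ x β` is some stage
  -- containing `x`, not necessarily the least.
  let T : ℕ → X → Finset (ℕ × ℕ × ℕ) := fun k β =>
    (hfin k β).toFinset.image fun x => (ρ x β, lev (ρ x β) x, lev k x)
  let col : X → X → ℕ × ℕ × ℕ × Finset (ℕ × ℕ × ℕ) := fun α β =>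
    (ρ α β, lev (ρ α β) α, lev (ρ α β) β, T (ρ α β) β)
  let F : X → X → ℕ := fun x y => Encodable.encode (col (min x y) (max x y))
  have hFcomm : ∀ x y, F x y = F y x := fun x y => by
    simp only [F, min_comm, max_comm]
  have hFlt : ∀ {x y}, x < y → F x y = Encodable.encode (col x y) := fun {x y} h => by
    simp only [F, min_eq_left h.le, max_eq_right h.le]
  have hFgt : ∀ {x y}, y < x → F x y = Encodable.encode (col y x) := fun {x y} h => by
    rw [hFcomm, hFlt h]
  have hmem : ∀ {k x y z}, x ∈ G k z → y ∈ G k z → x ≤ y → x ∈ G k y := fun {k x y z} hx hy h => by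
    rw [hcoh k y z hy]
    exact ⟨hx, h⟩
  have hlev : ∀ {k x y}, x ∈ G k y → x ≠ y → lev k x < lev k y := fun {k x y} h hne => by
    refine Set.ncard_lt_ncard ⟨?_, fun h' => hne ?_⟩ (hfin k y)
    · rw [hcoh k x y h]
      exact Set.inter_subset_left
    · exact le_antisymm (hIic k y h) (hIic k x (h' (hself k y)))
  have hinj : ∀ {k x y z}, x ∈ G k z → y ∈ G k z → lev k x = lev k y → x = y := by
    intro k x y z hx hy h
    by_contra hne
    rcases le_total x y with h' | h'
    · exact (hlev (hmem hx hy h') hne).ne h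
    · exact (hlev (hmem hy hx h') (Ne.symm hne)).ne' h
  -- If `q < p < q'`, equal colours would equate the levels of `q` and `p` at one stage, where that
  -- of `q` is smaller. If `q, q' < p`, both lie in one `G k p` at the same level and coincide.
  have hlow : ∀ {p q q'}, q ≠ q' → p ≠ q → p ≠ q' → F p q = F p q' → p < q := by
    intro p q q' hqq hpq hpq' h
    by_contra hlt
    have hlt : q < p := lt_of_le_of_ne (not_lt.1 hlt) (Ne.symm hpq)
    rw [hFgt hlt] at h
    rcases hpq'.lt_or_gt with h' | h'
    · rw [hFlt h'] at h
      simp only [Encodable.encode_inj, col, Prod.mk.injEq] at h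
      obtain ⟨h1, h2, h3, -⟩ := h
      have e1 := hlev (hρ _ _ hlt.le) hlt.ne
      have e2 := hlev (hρ _ _ h'.le) h'.ne
      rw [← h1] at h2 h3 e2
      omega
    · rw [hFgt h'] at h
      simp only [Encodable.encode_inj, col, Prod.mk.injEq] at h
      obtain ⟨h1, h2, -, -⟩ := h
      rw [← h1] at h2
      have e2 := hρ _ _ h'.le
      rw [← h1] at e2
      exact hqq (hinj (hρ _ _ hlt.le) e2 h2)
  refine ⟨F, hFcomm, ?_⟩
  have core : ∀ (a b : Fin 2 → X) (c : Fin 2 → Fin 2 → X) (ε δ : ℕ × ℕ × ℕ × Finset (ℕ × ℕ × ℕ)),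
      a.Injective → b.Injective → (∀ i j, a i ≠ b j) → (∀ i j, a i < c i j) →
      (∀ i j, b j < c i j) → (∀ i j, col (a i) (c i j) = ε) → (∀ i j, col (b j) (c i j) = δ) →
      ε.1 ≤ δ.1 → False := by
    rintro a b c ⟨k₀, u₀, v₀, S₀⟩ ⟨k, u, v, S⟩ ha hb hab hac hbc hε hδ (hk : k₀ ≤ k)
    simp only [col, Prod.mk.injEq] at hε hδ
    have ha0 : ∀ i j, a i ∈ G k₀ (c i j) := fun i j => by
      rw [← (hε i j).1]
      exact hρ _ _ (hac i j).le
    have hak : ∀ i j, a i ∈ G k (c i j) := fun i j => hkmono _ hk (ha0 i j)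
    have hbk : ∀ i j, b j ∈ G k (c i j) := fun i j => by
      rw [← (hδ i j).1]
      exact hρ _ _ (hbc i j).le
    have hbu : ∀ j, lev k (b j) = u := fun j => by
      obtain ⟨h1, h2, -⟩ := hδ 0 j
      rwa [h1] at h2
    have hau : ∀ i, lev k₀ (a i) = u₀ := fun i => by
      obtain ⟨h1, h2, -⟩ := hε i 0
      rwa [h1] at h2
    -- Otherwise `b 0` and `b 1` would both lie in `G k (a i)` at level `u`, hence be equal.
    have hlt : ∀ i, lev k (a i) < u := fun i => by
      by_contra! h
      have hba : ∀ j, b j ∈ G k (a i) := fun j => by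
        refine hmem (hbk i j) (hak i j) ?_
        by_contra! h'
        exact (hlev (hmem (hak i j) (hbk i j) h'.le) h'.ne).not_ge (by rwa [hbu])
      exact absurd (hb (hinj (hba 0) (hba 1) (by rw [hbu, hbu]))) (by decide)
    have hab' : ∀ i, a i ∈ G k (b 0) := fun i => by
      refine hmem (hak i 0) (hbk i 0) ?_
      by_contra! h'
      have := hlev (hmem (hbk i 0) (hak i 0) h'.le) h'.ne
      rw [hbu] at this
      exact this.not_gt (hlt i)
    -- The entry of `a 1` in the table of `c 1 0` must also occur in the equal table of `c 0 0`.
    -- There stage `k₀` and level `u₀` identify its source as `a 0`, so `a 0` and `a 1` have the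
    -- same level at stage `k`; both lie in `G k (b 0)`, hence they coincide.
    have hS : (k₀, u₀, lev k (a 1)) ∈ S := by
      obtain ⟨h1, -, -, h2⟩ := hδ 1 0
      rw [← h2, h1, Finset.mem_image]
      refine ⟨a 1, by simpa using hak 1 0, ?_⟩
      rw [(hε 1 0).1, hau]
    obtain ⟨h1, -, -, h2⟩ := hδ 0 0
    rw [← h2, h1, Finset.mem_image] at hS
    obtain ⟨x, hx, hxe⟩ := hS
    simp only [Prod.mk.injEq] at hxe
    obtain ⟨e1, e2, e3⟩ := hxe
    rw [e1] at e2
    have hxc : x ∈ G k (c 0 0) := by simpa using hx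
    have hx0 : x ∈ G k₀ (c 0 0) := by
      rw [← e1]
      exact hρ _ _ (hIic _ _ hxc)
    obtain rfl : x = a 0 := hinj hx0 (ha0 0 0) (by rw [e2, hau])
    exact absurd (ha (hinj (hab' 0) (hab' 1) e3)) (by decide)
  intro a b c ε δ ha hb hab hc hc' hac hbc hε hδ
  have hac' : ∀ i j, a i < c i j := fun i j =>
    -- In `Fin 2`, `j + 1` is the other index.
    hlow (q' := c i (j + 1)) (fun h => absurd (hc i h) (by omega)) (hac _ _) (hac _ _)
      (by rw [hε, hε])
  have hbc' : ∀ i j, b j < c i j := fun i j =>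
    hlow (q' := c (i + 1) j) (fun h => absurd (hc' j h) (by omega)) (hbc _ _) (hbc _ _)
      (by rw [hδ, hδ])
  have hε' : ∀ i j, col (a i) (c i j) = col (a 0) (c 0 0) := fun i j => by
    have := (hε i j).trans (hε 0 0).symm
    rwa [hFlt (hac' _ _), hFlt (hac' _ _), Encodable.encode_inj] at this
  have hδ' : ∀ i j, col (b j) (c i j) = col (b 0) (c 0 0) := fun i j => by
    have := (hδ i j).trans (hδ 0 0).symm
    rwa [hFlt (hbc' _ _), hFlt (hbc' _ _), Encodable.encode_inj] at this
  rcases le_total (col (a 0) (c 0 0)).1 (col (b 0) (c 0 0)).1 with h | h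
  · exact core a b c _ _ ha hb hab hac' hbc' hε' hδ' h
  -- The pattern is symmetric under exchanging `a` with `b` and transposing `c`.
  · exact core b a (fun i j => c j i) _ _ hb ha (fun i j => (hab j i).symm) (fun i j => hbc' j i)
      (fun i j => hac' j i) (fun i j => hδ' j i) (fun i j => hε' j i) h

/-! ### Failure of the identities at `ℵ₁` -/

theorem countable_Iio_aleph_one (β : (aleph.{u} 1).ord.ToType) : (Set.Iio β).Countable := by
  rw [← le_aleph0_iff_set_countable, ← lt_aleph_one_iff]
  simpa using mk_Iio_lt β (by simp)

/-- An injection respecting the classes would carry the points `a`, `b`, `c` to the pattern that the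
colouring omits. The threshold `M` only separates the `c i j` from the other points. -/
theorem ofClasses_notMem_ID₂ {N M : ℕ} {ι : Type} {C : ι → Set (Pairs (Fin N))}
    {hC : ∀ i j b, b ∈ C i → b ∈ C j → i = j} (p q : ι) (a b : Fin 2 → ℕ) (c : Fin 2 → Fin 2 → ℕ)
    (ha : a.Injective) (hb : b.Injective) (hab : ∀ i j, a i ≠ b j) (hc : ∀ i, (c i).Injective)
    (hc' : ∀ j, Function.Injective fun i => c i j) (haM : ∀ i, a i < M) (hbM : ∀ j, b j < M)
    (hcM : ∀ i j, M ≤ c i j) (hcN : ∀ i j, c i j < N)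
    (hp : ∀ i j s, IsPair s (a i) (c i j) → s ∈ C p)
    (hq : ∀ i j s, IsPair s (b j) (c i j) → s ∈ C q) :
    (⟨N, ofClasses C hC⟩ : Σ N : ℕ, TwoIdentity (Fin N)) ∉
      ID₂ (aleph.{u} 1) aleph0.{u} := by
  classical
  obtain ⟨F, hF, H⟩ := exists_colouring_omitting (X := (aleph.{u} 1).ord.ToType)
    countable_Iio_aleph_one
  have : Infinite (aleph0.{u}).ord.ToType := by
    rw [infinite_iff, mk_ord_toType]
  let e : ℕ ↪ (aleph0.{u}).ord.ToType := Infinite.natEmbedding _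
  let f : Finset (aleph.{u} 1).ord.ToType → (aleph0.{u}).ord.ToType := fun s =>
    e (if h : s.Nonempty then F (s.min' h) (s.max' h) else 0)
  have hf : ∀ x y, f {x, y} = e (F x y) := fun x y => by
    simp only [f, Finset.insert_nonempty, dif_pos]
    congr 1
    rcases le_total x y with h | h
    · simp [Finset.min'_insert, Finset.max'_insert, h]
    · simp [Finset.min'_insert, Finset.max'_insert, h, hF x y]
  intro hID
  obtain ⟨h, hh⟩ := hID f
  have hMN : M < N := (hcM 0 0).trans_lt (hcN 0 0)
  let a' : Fin 2 → Fin N := fun i => ⟨a i, (haM i).trans hMN⟩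
  let b' : Fin 2 → Fin N := fun i => ⟨b i, (hbM i).trans hMN⟩
  let c' : Fin 2 → Fin 2 → Fin N := fun i j => ⟨c i j, hcN i j⟩
  have hac : ∀ i j, a' i ≠ c' i j := fun i j h =>
    ((haM i).trans_le (hcM i j)).ne (Fin.mk.inj h)
  have hbc : ∀ i j, b' j ≠ c' i j := fun i j h =>
    ((hbM j).trans_le (hcM i j)).ne (Fin.mk.inj h)
  have key : ∀ (r : ι) (x y x' y' : Fin N) (hxy : x ≠ y) (hxy' : x' ≠ y'),
      ⟨{x, y}, Finset.card_pair hxy⟩ ∈ C r → ⟨{x', y'}, Finset.card_pair hxy'⟩ ∈ C r →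
        F (h x) (h y) = F (h x') (h y') := by
    intro r x y x' y' hxy hxy' h1 h2
    have := hh {x, y} {x', y'}
      (Or.inl ⟨Finset.card_pair hxy, Finset.card_pair hxy', Or.inr ⟨r, h1, h2⟩⟩)
    rw [Finset.map_insert, Finset.map_singleton, Finset.map_insert, Finset.map_singleton, hf,
      hf] at this
    exact e.injective this
  have hpm : ∀ i j, ⟨{a' i, c' i j}, Finset.card_pair (hac i j)⟩ ∈ C p := fun i j =>
    hp i j _ (by simp [IsPair, a', c'])
  have hqm : ∀ i j, ⟨{b' j, c' i j}, Finset.card_pair (hbc i j)⟩ ∈ C q := fun i j =>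
    hq i j _ (by simp [IsPair, b', c'])
  refine H (fun i => h (a' i)) (fun j => h (b' j)) (fun i j => h (c' i j))
    (F (h (a' 0)) (h (c' 0 0))) (F (h (b' 0)) (h (c' 0 0)))
    (fun i j hij => ha (Fin.mk.inj (h.injective hij)))
    (fun i j hij => hb (Fin.mk.inj (h.injective hij)))
    (fun i j hij => hab i j (Fin.mk.inj (h.injective hij)))
    (fun i j k hij => hc i (Fin.mk.inj (h.injective hij)))
    (fun i j k hij => hc' i (Fin.mk.inj (h.injective hij)))
    (fun i j hij => hac i j (h.injective hij)) (fun i j hij => hbc i j (h.injective hij))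
    (fun i j => key p _ _ _ _ (hac _ _) (hac _ _) (hpm _ _) (hpm _ _))
    (fun i j => key q _ _ _ _ (hbc _ _) (hbc _ _) (hqm _ _) (hqm _ _))

theorem sPrime_notMem_ID₂ {n : ℕ} (hn : 2 ≤ n) : sPrime n ∉ ID₂ (aleph.{u} 1) aleph0.{u} := by
  have hi : ∀ i : Fin 2, (i : ℕ) < n := fun i => i.isLt.trans_le hn
  have hlt : ∀ i j : Fin 2, n * (i : ℕ) + j < n ^ 2 := fun i j => by
    have h1 := hi j
    have h2 : n * (i + 1 : ℕ) ≤ n * n := Nat.mul_le_mul_left n (hi i)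
    rw [mul_add, mul_one] at h2
    rw [sq]
    omega
  refine ofClasses_notMem_ID₂ (M := 2 * n) 0 1 (fun i => i) (fun j => n + j)
    (fun i j => 2 * n + n * i + j) (fun i j h => Fin.ext h)
    (fun i j h => Fin.ext (Nat.add_left_cancel h)) (fun i j h => ?_)
    (fun i j k h => Fin.ext (Nat.add_left_cancel h)) (fun i j k h => Fin.ext ?_)
    (fun i => ?_) (fun j => ?_) (fun i j => ?_) (fun i j => ?_)
    (fun i j s hs => ⟨i, j, hi i, hi j, hs⟩) (fun i j s hs => ⟨i, j, hi i, hi j, hs⟩)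
  · have := hi i
    omega
  · exact Nat.eq_of_mul_eq_mul_left (by omega : 0 < n)
      (Nat.add_left_cancel (Nat.add_right_cancel h))
  · have := hi i
    omega
  · have := hi j
    omega
  · omega
  · have := hlt i j
    omega

theorem sDoublePrime_notMem_ID₂ {n : ℕ} (hn : 2 ≤ n) :
    sDoublePrime n ∉ ID₂ (aleph.{u} 1) aleph0.{u} := by
  obtain ⟨n, rfl⟩ := Nat.exists_eq_add_of_le' hn
  -- The sequences `(d, i, 0, …, 0)` give two leaves on each side of the root, so the two classes at
  -- the root contain the pattern.
  let ν : Fin 2 → Fin 2 → Fin (n + 2) → Fin 2 := fun d i => Fin.cons d (Fin.cons i 0)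
  have hν0 : ∀ d i, ν d i 0 = d := fun _ _ => rfl
  have hν1 : ∀ d i, ν d i 1 = i := fun _ _ => rfl
  have hinj : ∀ d, Function.Injective fun i => lexNumber (ν d i) := fun d i j h => by
    exact (hν1 d i).symm.trans ((congrFun (lexNumber_injective h) 1).trans (hν1 d j))
  have hne : ∀ i j, lexNumber (ν 0 i) ≠ lexNumber (ν 1 j) := fun i j h => by
    have := congrFun (lexNumber_injective h) 0
    simp [hν0] at this
  have hE : ∀ d i, ExtendsBy (m := (⟨0, Nat.succ_pos _⟩ : Fin (n + 2))) Fin.elim0 d (ν d i) :=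
    fun d i => extendsBy_zero.2 (hν0 d i)
  refine ofClasses_notMem_ID₂ (M := 2 ^ (n + 2)) (⟨⟨0, Nat.succ_pos _⟩, Fin.elim0⟩, 0)
    (⟨⟨0, Nat.succ_pos _⟩, Fin.elim0⟩, 1) (fun i => lexNumber (ν 0 i)) (fun j => lexNumber (ν 1 j))
    (fun i j => 2 ^ (n + 2) + 2 ^ (n + 2) * lexNumber (ν 0 i) + lexNumber (ν 1 j)) (hinj 0) (hinj 1)
    hne (fun i j k h => hinj 1 (Nat.add_left_cancel h)) (fun j i k h => hinj 0 ?_)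
    (fun i => lexNumber_lt _) (fun j => lexNumber_lt _) (fun i j => ?_) (fun i j => ?_)
    (fun i j s hs => ⟨ν 0 i, ν 1 j, hE 0 i, hE 1 j, hs⟩)
    (fun i j s hs => ⟨ν 0 i, ν 1 j, hE 0 i, hE 1 j, hs⟩)
  · exact Nat.eq_of_mul_eq_mul_left (by positivity : 0 < 2 ^ (n + 2))
      (Nat.add_left_cancel (Nat.add_right_cancel h))
  · rw [add_assoc]
    exact Nat.le_add_right _ _
  · have h1 := lexNumber_lt (ν 1 j)
    have h2 := Nat.mul_le_mul_left (2 ^ (n + 2)) (lexNumber_lt (ν 0 i))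
    rw [← pow_add, ← two_mul, Nat.mul_succ] at h2
    omega

end CardinalIdentity

theorem claim2p4 :
    (∀ μ θ : Cardinal.{u}, Order.IsSuccLimit μ → CardinalIdentity.IsCompactCardinal θ →
      μ.ord.cof < θ → θ < μ → ∀ n : ℕ,
        (CardinalIdentity.sPrime n ∈ CardinalIdentity.OID₂ (Order.succ μ) μ ∧
          CardinalIdentity.sPrime n ∈ CardinalIdentity.ID₂ (Order.succ μ) μ) ∧
        (CardinalIdentity.sDoublePrime n ∈ CardinalIdentity.OID₂ (Order.succ μ) μ ∧
          CardinalIdentity.sDoublePrime n ∈ CardinalIdentity.ID₂ (Order.succ μ) μ)) ∧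
    (∀ n : ℕ, 2 ≤ n →
      CardinalIdentity.sPrime n ∉ CardinalIdentity.ID₂ (Cardinal.aleph.{u} 1) Cardinal.aleph0.{u} ∧
      CardinalIdentity.sDoublePrime n ∉
        CardinalIdentity.ID₂ (Cardinal.aleph.{u} 1) Cardinal.aleph0.{u}) := by
  refine ⟨fun μ θ hμ hθ hcof hlt n => ?_, fun n hn =>
    ⟨CardinalIdentity.sPrime_notMem_ID₂ hn, CardinalIdentity.sDoublePrime_notMem_ID₂ hn⟩⟩
  have h1 := CardinalIdentity.sPrime_mem_OID₂ hμ hθ hcof hlt n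
  have h2 := CardinalIdentity.sDoublePrime_mem_OID₂ hμ hθ hcof hlt n
  exact ⟨⟨h1, CardinalIdentity.OID₂_subset_ID₂ _ _ h1⟩, ⟨h2, CardinalIdentity.OID₂_subset_ID₂ _ _ h2⟩⟩
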